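/- **Theorem 1 ($\alpha$-$z$ Rényi texture measure).** Let $d\ge 1$, and let $\mathcal D$ be the set of density matrices on $\mathbb C^d$, that is, positive semidefinite complex $d\times d$ matrices of trace $1$. Put $|f_1\rangle=\frac1{\sqrt d}\sum_{j=1}^d|j\rangle$, where $\{|j\rangle\}$ is the computational (standard) basis, and $f_1=|f_1\rangle\langle f_1|$. A texture-free operation is a completely positive trace-preserving linear map $\Phi$ on $d\times d$ complex matrices with $\Phi(f_1)=f_1$. Let $\alpha\in(0,1)$ and $z\ge\max\{\alpha,1-\alpha\}$, and for $\tau,\sigma\in\mathcal D$ let $$f_{\alpha,z}(\tau\|\sigma)=\operatorname{Tr}\Big[\big(\tau^{\frac{\alpha}{2z}}\,\sigma^{\frac{1-\alpha}{z}}\,\tau^{\frac{\alpha}{2z}}\big)^{z}\Big],$$ with real powers of positive semidefinite matrices taken by functional calculus. Then the function $$\mathcal T^{\mathrm{GR}}_{\alpha,z}(\rho)=1-f_{\alpha,z}(f_1\|\rho),\qquad \rho\in\mathcal D,$$ is a valid texture measure, which means: 1. (Non-negativity) $\mathcal T^{\mathrm{GR}}_{\alpha,z}(\rho)\ge 0$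 for every $\rho\in\mathcal D$, and $\mathcal T^{\mathrm{GR}}_{\alpha,z}(f_1)=0$. 2. (Monotonicity) $\mathcal T^{\mathrm{GR}}_{\alpha,z}(\Phi(\rho))\le \mathcal T^{\mathrm{GR}}_{\alpha,z}(\rho)$ for every $\rho\in\mathcal D$ and every texture-free operation $\Phi$. 3. (Convexity) $\mathcal T^{\mathrm{GR}}_{\alpha,z}\big(\sum_n p_n\rho_n\big)\le\sum_n p_n\,\mathcal T^{\mathrm{GR}}_{\alpha,z}(\rho_n)$ for every finite family of states $\rho_n\in\mathcal D$ and every probability distribution $(p_n)$, $p_n\ge0$, $\sum_n p_n=1$. Moreover, $f_{\alpha,z}(f_1\|\rho)=\big(\langle f_1|\rho^{\frac{1-\alpha}{z}}|f_1\rangle\big)^{z}$ for every $\rho\in\mathcal D$. -/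

import Mathlib

namespace QuantumTexture

open scoped MatrixOrder ComplexOrder

/-- Quantum states (density matrices) on `ℂ^d`. -/
structure IsState {d : ℕ} (ρ : Matrix (Fin d) (Fin d) ℂ) : Prop where
  posSemidef : ρ.PosSemidef
  trace_eq_one : ρ.trace = 1

/-- The vector `|f₁⟩ = d^{-1/2} ∑ⱼ |j⟩`. -/
noncomputable def ketF1 (d : ℕ) : Fin d → ℂ :=
  fun _ => ((1 / Real.sqrt d : ℝ) : ℂ)

/-- The texture-free state `f₁ = |f₁⟩⟨f₁|`. -/
noncomputable def f1 (d : ℕ) : Matrix (Fin d) (Fin d) ℂ :=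
  Matrix.vecMulVec (ketF1 d) (star (ketF1 d))

section Channels

open scoped CStarAlgebra Matrix.Norms.L2Operator

/-- Texture-free operations: completely positive trace-preserving maps that fix `f₁`.
Here `→CP` is Mathlib's notion of completely positive linear map, for the C⋆-algebra of
`d × d` complex matrices (all ampliations to `k × k` block matrices preserve positivity). -/
structure IsTextureFree {d : ℕ}
    (Φ : Matrix (Fin d) (Fin d) ℂ →ₗ[ℂ] Matrix (Fin d) (Fin d) ℂ) : Prop where
  completelyPositive :
    ∃ Ψ : Matrix (Fin d) (Fin d) ℂ →CP Matrix (Fin d) (Fin d) ℂ, Ψ.toLinearMap = Φ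
  trace_preserving : ∀ A, (Φ A).trace = A.trace
  fixes_f1 : Φ (f1 d) = f1 d

end Channels

/-- The three axioms of a valid texture measure, for a real function of `d × d` matrices whose
values matter on states only. -/
structure IsTextureMeasure (d : ℕ) (T : Matrix (Fin d) (Fin d) ℂ → ℝ) : Prop where
  nonneg : ∀ ρ, IsState ρ → 0 ≤ T ρ
  map_f1 : T (f1 d) = 0
  monotone : ∀ ρ, IsState ρ → ∀ Φ, IsTextureFree Φ → T (Φ ρ) ≤ T ρ
  convex : ∀ (m : ℕ) (ρ : Fin m → Matrix (Fin d) (Fin d) ℂ) (p : Fin m → ℝ),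
    (∀ n, IsState (ρ n)) → (∀ n, 0 ≤ p n) → ∑ n, p n = 1 →
      T (∑ n, p n • ρ n) ≤ ∑ n, p n * T (ρ n)

/-- `f_{α,z}(τ‖σ) = Tr (τ^{α/2z} σ^{(1-α)/z} τ^{α/2z})^z`. Real powers of positive semidefinite
matrices are taken by functional calculus, and the trace is that of the `z`-th power of the
product, a positive semidefinite matrix, so it is a non-negative real number. -/
noncomputable def renyiF {d : ℕ} (α z : ℝ) (τ σ : Matrix (Fin d) (Fin d) ℂ) : ℝ :=
  (Matrix.trace
    ((τ ^ (α / (2 * z)) * σ ^ ((1 - α) / z) * τ ^ (α / (2 * z))) ^ z)).re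

/-- The `α`-`z` Rényi texture quantifier `1 - f_{α,z}(f₁‖ρ)`. -/
noncomputable def textureGR {d : ℕ} (α z : ℝ) (ρ : Matrix (Fin d) (Fin d) ℂ) : ℝ :=
  1 - renyiF α z (f1 d) ρ

/-- The expectation value `⟨f₁|A|f₁⟩`. -/
noncomputable def expF1 {d : ℕ} (A : Matrix (Fin d) (Fin d) ℂ) : ℂ :=
  dotProduct (star (ketF1 d)) (A.mulVec (ketF1 d))

end QuantumTexture

open scoped MatrixOrder

namespace QuantumTexture
open scoped MatrixOrder ComplexOrder
open Matrix

/-! Let v be the unit vector `ketF1 d` and s = (1-α)/z, so 0 < s ≤ 1. Positive powers of the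
projection f₁ equal f₁, so the sandwiched operator is ⟨v|ρ^s|v⟩ f₁ and f = ⟨v|ρ^s|v⟩^z.
Non-negativity follows from ρ^s ≤ 1.

Monotonicity: for a channel Φ fixing |v⟩⟨v|, put K y = Φ(|y⟩⟨v|) v. Two-positivity gives K A K† ≤
Φ(A), trace preservation makes K† a contraction, and both K and K† fix v. The Hansen-type inequality
`quadRe_rpow_le_of_contraction` then gives ⟨v|A^s|v⟩ ≤ ⟨v|Φ(A)^s|v⟩.

Convexity: ⟨v|A^s|v⟩ is concave, increasing and homogeneous of degree s, so its power 1/s is concave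
(`ConcaveOn.rpow_inv_of_homogeneous`). Now f is the power 1-α of that function, and x^(1-α) is
increasing and concave. -/

lemma conjTranspose_vecMulVec_star {m : Type*} (u w : m → ℂ) :
    (vecMulVec u (star w))ᴴ = vecMulVec w (star u) := by
  simp [conjTranspose_vecMulVec]

/-! ### Quadratic forms, resolvents and a Hansen-type inequality -/

section RealPowers
open scoped Matrix.Norms.L2Operator

variable {n : Type*} [Fintype n]

lemma star_dotProduct_mulVec (A : Matrix n n ℂ) (x y : n → ℂ) :
    star x ⬝ᵥ A *ᵥ y = star (Aᴴ *ᵥ x) ⬝ᵥ y := by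
  rw [dotProduct_mulVec, star_mulVec, conjTranspose_conjTranspose]

/-- The real part of the quadratic form of a complex matrix. -/
noncomputable def quadRe (x : n → ℂ) : Matrix n n ℂ →ₗ[ℝ] ℝ where
  toFun A := (star x ⬝ᵥ A *ᵥ x).re
  map_add' A B := by simp [add_mulVec, dotProduct_add]
  map_smul' c A := by simp [smul_mulVec, dotProduct_smul]

lemma quadRe_apply (x : n → ℂ) (A : Matrix n n ℂ) : quadRe x A = (star x ⬝ᵥ A *ᵥ x).re := rfl

lemma quadRe_nonneg {A : Matrix n n ℂ} (hA : A.PosSemidef) (x : n → ℂ) : 0 ≤ quadRe x A :=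
  (Complex.le_def.1 (hA.dotProduct_mulVec_nonneg x)).1

lemma quadRe_mono {A B : Matrix n n ℂ} (h : A ≤ B) (x : n → ℂ) : quadRe x A ≤ quadRe x B := by
  have := quadRe_nonneg (Matrix.le_iff.1 h) x
  rw [map_sub] at this; linarith

lemma re_star_dotProduct_comm (x y : n → ℂ) : (star x ⬝ᵥ y).re = (star y ⬝ᵥ x).re := by
  rw [star_dotProduct]; simp

lemma vecMulVec_star_mulVec (u w v : n → ℂ) : vecMulVec u (star w) *ᵥ v = (star w ⬝ᵥ v) • u := by
  ext i; simp [vecMulVec_mulVec, mul_comm]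

variable [DecidableEq n]

lemma rpow_smul_nonneg {A : Matrix n n ℂ} (hA : 0 ≤ A) {c s : ℝ} (hc : 0 ≤ c) (hs : 0 < s) :
    (c • A) ^ s = c ^ s • A ^ s := by
  rw [CFC.rpow_eq_cfc_real (a := c • A) (smul_nonneg hc hA), CFC.rpow_eq_cfc_real (a := A) hA,
    ← cfc_comp_smul c (fun x : ℝ => x ^ s) A
      (Continuous.continuousOn (by fun_prop (disch := grind))) hA.isSelfAdjoint,
    ← cfc_smul _ _ _ (Continuous.continuousOn (by fun_prop (disch := grind)))]
  refine cfc_congr fun x hx => ?_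
  have hx0 : 0 ≤ x := spectrum_nonneg_of_nonneg hA hx
  simp [Real.mul_rpow hc hx0]

/-- Expand the form of B at x - B⁻¹v, which is non-negative; equality holds at x = B⁻¹v. -/
lemma quadRe_inv_variational {B : Matrix n n ℂ} (hB : B.PosDef) (v x : n → ℂ) :
    2 * (star v ⬝ᵥ x).re - quadRe x B ≤ quadRe v B⁻¹ := by
  have h := quadRe_nonneg hB.posSemidef (x - B⁻¹ *ᵥ v)
  have hBv : B *ᵥ (B⁻¹ *ᵥ v) = v := by
    rw [mulVec_mulVec, mul_nonsing_inv _ ((isUnit_iff_isUnit_det _).1 hB.isUnit), one_mulVec]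
  have h1 : star (B⁻¹ *ᵥ v) ⬝ᵥ B *ᵥ x = star v ⬝ᵥ x := by
    rw [star_dotProduct_mulVec, hB.1.eq, hBv]
  have h2 : star (B⁻¹ *ᵥ v) ⬝ᵥ v = star v ⬝ᵥ B⁻¹ *ᵥ v := by
    rw [star_dotProduct_mulVec, hB.inv.1.eq]
  have h3 : (star x ⬝ᵥ v).re = (star v ⬝ᵥ x).re := by
    rw [star_dotProduct]; simp
  simp only [quadRe_apply, mulVec_sub, hBv, star_sub, dotProduct_sub, sub_dotProduct, h1, h2,
    Complex.sub_re, h3] at h ⊢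
  linarith

/-- Reduces comparison of fractional powers to a reversed comparison of resolvents. -/
lemma cfcₙ_rpowIntegrand₀₁_eq {A : Matrix n n ℂ} (hA : 0 ≤ A) {p t : ℝ} (hp : p ∈ Set.Ioo 0 1)
    (ht : 0 < t) : cfcₙ (Real.rpowIntegrand₀₁ p t) A =
      t ^ (p - 1) • (1 : Matrix n n ℂ) - t ^ p • (t • (1 : Matrix n n ℂ) + A)⁻¹ := by
  have hsp : ∀ r ∈ spectrum ℝ A, 0 ≤ r := fun r hr => spectrum_nonneg_of_nonneg hA hr
  rw [cfcₙ_eq_cfc (hf := (Real.continuousOn_rpowIntegrand₀₁_Ici hp ht).mono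
    fun r hr => quasispectrum_nonneg_of_nonneg A hA r hr), Real.rpowIntegrand₀₁_eq_sub hp.2.ne ht]
  have hg : ContinuousOn (fun z : ℝ => (t + z)⁻¹) (spectrum ℝ A) :=
    ContinuousOn.inv₀ (by fun_prop) fun r hr => (add_pos_of_pos_of_nonneg ht (hsp r hr)).ne'
  rw [cfc_sub (fun _ : ℝ => t ^ (p - 1)) (fun z : ℝ => t ^ p * (t + z)⁻¹) A, cfc_const ..,
    cfc_const_mul .., cfc_inv _ _ fun r hr => (add_pos_of_pos_of_nonneg ht (hsp r hr)).ne',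
    cfc_const_add .., cfc_id' .., nonsing_inv_eq_ringInverse]
  simp [Algebra.algebraMap_eq_smul_one]

/-- A form of Hansen's inequality, tested on a fixed vector of the contraction. -/
lemma quadRe_rpow_le_of_contraction {A B K : Matrix n n ℂ} (hA : 0 ≤ A) (hB : 0 ≤ B) {v : n → ℂ}
    (hK : K *ᵥ v = v) (hK' : Kᴴ *ᵥ v = v)
    (hcontr : ∀ x, (star (Kᴴ *ᵥ x) ⬝ᵥ (Kᴴ *ᵥ x)).re ≤ (star x ⬝ᵥ x).re)
    (hle : ∀ x, quadRe (Kᴴ *ᵥ x) A ≤ quadRe x B) {s : ℝ} (hs0 : 0 < s) (hs1 : s ≤ 1) :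
    quadRe v (A ^ s) ≤ quadRe v (B ^ s) := by
  rcases hs1.eq_or_lt with rfl | hs1
  · rw [CFC.rpow_one A, CFC.rpow_one B]
    simpa [hK'] using hle v
  lift s to NNReal using hs0.le
  have hs : s ∈ Set.Ioo (0 : NNReal) 1 := ⟨by exact_mod_cast hs0, by exact_mod_cast hs1⟩
  have hs' : (s : ℝ) ∈ Set.Ioo (0 : ℝ) 1 := ⟨hs0, hs1⟩
  obtain ⟨μ, hμ⟩ := CFC.exists_measure_nnrpow_eq_integral_cfcₙ_rpowIntegrand₀₁ (Matrix n n ℂ) hs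
  let φ : Matrix n n ℂ →L[ℝ] ℝ := LinearMap.toContinuousLinearMap (quadRe v)
  have key : ∀ C : Matrix n n ℂ, 0 ≤ C → MeasureTheory.IntegrableOn
      (fun t => quadRe v (cfcₙ (Real.rpowIntegrand₀₁ s t) C)) (Set.Ioi 0) μ ∧
      quadRe v (C ^ (s : ℝ)) =
        ∫ t in Set.Ioi 0, quadRe v (cfcₙ (Real.rpowIntegrand₀₁ s t) C) ∂μ := by
    intro C hC
    refine ⟨φ.integrable_comp (hμ C hC).1, ?_⟩
    rw [← CFC.nnrpow_eq_rpow hs.1, (hμ C hC).2]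
    exact (φ.integral_comp_comm (hμ C hC).1).symm
  rw [(key A hA).2, (key B hB).2]
  refine MeasureTheory.setIntegral_mono_on (key A hA).1 (key B hB).1 measurableSet_Ioi ?_
  intro t (ht : 0 < t)
  rw [cfcₙ_rpowIntegrand₀₁_eq hA hs' ht, cfcₙ_rpowIntegrand₀₁_eq hB hs' ht]
  have hpd : ∀ C : Matrix n n ℂ, 0 ≤ C → (t • (1 : Matrix n n ℂ) + C).PosDef := fun C hC =>
    (PosDef.one.smul ht).add_posSemidef (nonneg_iff_posSemidef.1 hC)
  have hinv : quadRe v (t • (1 : Matrix n n ℂ) + B)⁻¹ ≤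
      quadRe v (t • (1 : Matrix n n ℂ) + A)⁻¹ := by
    set w := (t • (1 : Matrix n n ℂ) + B)⁻¹ *ᵥ v with hw
    have hBw : (t • (1 : Matrix n n ℂ) + B) *ᵥ w = v := by
      rw [hw, mulVec_mulVec, mul_nonsing_inv _ ((isUnit_iff_isUnit_det _).1 (hpd B hB).isUnit),
        one_mulVec]
    -- Trial vector K†w: since K v = v the linear term stays 2⟨v,w⟩, while the form of t + A at K†w
    -- is at most that of t + B at w, which is ⟨v,w⟩.
    refine le_trans ?_ (quadRe_inv_variational (hpd A hA) v (Kᴴ *ᵥ w))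
    have h1 : star v ⬝ᵥ Kᴴ *ᵥ w = star v ⬝ᵥ w := by
      rw [star_dotProduct_mulVec, conjTranspose_conjTranspose, hK]
    have h2 : quadRe w (t • (1 : Matrix n n ℂ) + B) = (star v ⬝ᵥ w).re := by
      rw [quadRe_apply, hBw, star_dotProduct]; simp
    have h3 : quadRe v (t • (1 : Matrix n n ℂ) + B)⁻¹ = (star v ⬝ᵥ w).re := rfl
    have hone : ∀ x : n → ℂ, quadRe x (1 : Matrix n n ℂ) = (star x ⬝ᵥ x).re := fun x => by
      rw [quadRe_apply, one_mulVec]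
    rw [h1, h3]
    rw [map_add, map_smul, hone, smul_eq_mul] at h2 ⊢
    nlinarith [hcontr w, hle w]
  simp only [map_sub, map_smul, smul_eq_mul]
  have := Real.rpow_nonneg ht.le (s : ℝ)
  nlinarith

end RealPowers

/-! ### Two-positivity and the compression of a channel -/

section CompletePositivity
open scoped CStarAlgebra Matrix.Norms.L2Operator

lemma exists_eq_star_mul_self_of_nonneg {A : Type*} [NonUnitalCStarAlgebra A] [PartialOrder A]
    [StarOrderedRing A] {x : A} (hx : 0 ≤ x) : ∃ y, x = star y * y :=
  CStarAlgebra.nonneg_iff_eq_star_mul_self.1 hx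

/-- Completely positive maps send Gram matrices of two operators to Gram-type matrices. -/
lemma exists_gram_of_completelyPositiveMap {n : Type*} [Fintype n] [DecidableEq n]
    (Ψ : Matrix n n ℂ →CP Matrix n n ℂ) (a b : Matrix n n ℂ) :
    ∃ c e f g : Matrix n n ℂ,
      Ψ.toLinearMap (aᴴ * a) = cᴴ * c + eᴴ * e ∧ Ψ.toLinearMap (aᴴ * b) = cᴴ * f + eᴴ * g ∧
      Ψ.toLinearMap (bᴴ * b) = fᴴ * f + gᴴ * g := by
  -- The zero row makes the row (a, b) square without changing its Gram matrix; the factor N of the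
  -- image has two rows, hence two terms per entry.
  let G : CStarMatrix (Fin 2) (Fin 2) (Matrix n n ℂ) := CStarMatrix.ofMatrix !![a, b; 0, 0]
  obtain ⟨N, hN⟩ := exists_eq_star_mul_self_of_nonneg
    (Ψ.map_cstarMatrix_nonneg' 2 (star G * G) (star_mul_self_nonneg G))
  have hG : ∀ i j, Ψ.toLinearMap ((G 0 i)ᴴ * G 0 j) = (N 0 i)ᴴ * N 0 j + (N 1 i)ᴴ * N 1 j := by
    intro i j
    have h := congrArg (fun M : CStarMatrix (Fin 2) (Fin 2) (Matrix n n ℂ) => M i j) hN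
    simp only [CStarMatrix.map_apply, CStarMatrix.mul_apply, Fin.sum_univ_two,
      CStarMatrix.star_apply, star_eq_conjTranspose] at h
    have h0 : G 1 j = 0 := by fin_cases j <;> rfl
    rw [h0, mul_zero, add_zero] at h
    exact h
  exact ⟨N 0 0, N 1 0, N 0 1, N 1 1, hG 0 0, hG 0 1, hG 1 1⟩

variable {n : Type*} [Fintype n] [DecidableEq n]

lemma posSemidef_map (Ψ : Matrix n n ℂ →CP Matrix n n ℂ) {A : Matrix n n ℂ} (hA : A.PosSemidef) :
    (Ψ.toLinearMap A).PosSemidef := by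
  obtain ⟨a, rfl⟩ := exists_eq_star_mul_self_of_nonneg hA.nonneg
  obtain ⟨c, e, f, g, h, -, -⟩ := exists_gram_of_completelyPositiveMap Ψ a a
  rw [star_eq_conjTranspose, h]
  exact (posSemidef_conjTranspose_mul_self c).add (posSemidef_conjTranspose_mul_self e)

/-- By the Gram form, the expression is ‖cx + fy‖² + ‖ex + gy‖². -/
lemma completelyPositiveMap_quadratic_nonneg
    (Ψ : Matrix n n ℂ →CP Matrix n n ℂ) (a b : Matrix n n ℂ) (x y : n → ℂ) :
    0 ≤ quadRe x (Ψ.toLinearMap (aᴴ * a)) + 2 * (star x ⬝ᵥ Ψ.toLinearMap (aᴴ * b) *ᵥ y).re +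
      quadRe y (Ψ.toLinearMap (bᴴ * b)) := by
  obtain ⟨c, e, f, g, h1, h2, h3⟩ := exists_gram_of_completelyPositiveMap Ψ a b
  rw [h1, h2, h3]
  have hk : ∀ c f : Matrix n n ℂ, 0 ≤ quadRe x (cᴴ * c) + 2 * (star x ⬝ᵥ (cᴴ * f) *ᵥ y).re +
      quadRe y (fᴴ * f) := fun c f => by
    have h0 : 0 ≤ (star (c *ᵥ x + f *ᵥ y) ⬝ᵥ (c *ᵥ x + f *ᵥ y)).re :=
      (Complex.le_def.1 (dotProduct_star_self_nonneg _)).1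
    have hc := re_star_dotProduct_comm (c *ᵥ x) (f *ᵥ y)
    simp only [quadRe_apply, ← mulVec_mulVec, star_dotProduct_mulVec (_ᴴ),
      conjTranspose_conjTranspose]
    simp only [star_add, add_dotProduct, dotProduct_add, Complex.add_re] at h0
    linarith
  have := hk c f
  have := hk e g
  simp only [map_add, add_mulVec, dotProduct_add, Complex.add_re]
  linarith

lemma le_trace_smul_one {A : Matrix n n ℂ} (hA : A.PosSemidef) :
    A ≤ A.trace.re • (1 : Matrix n n ℂ) := by
  rw [← Algebra.algebraMap_eq_smul_one]
  refine le_algebraMap_of_spectrum_le (fun r hr => ?_) hA.1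
  rw [hA.1.spectrum_real_eq_range_eigenvalues] at hr
  obtain ⟨i, rfl⟩ := hr
  rw [hA.1.trace_eq_sum_eigenvalues]
  simpa using Finset.single_le_sum (fun j _ => hA.eigenvalues_nonneg j) (Finset.mem_univ i)

lemma quadRe_le_trace_mul {A : Matrix n n ℂ} (hA : A.PosSemidef) (x : n → ℂ) :
    quadRe x A ≤ A.trace.re * (star x ⬝ᵥ x).re := by
  have := quadRe_mono (le_trace_smul_one hA) x
  rwa [map_smul, quadRe_apply x 1, one_mulVec] at this

/-- The contraction `y ↦ Φ(|y⟩⟨v|) v` attached to a map fixing the pure state `|v⟩⟨v|`. -/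
noncomputable def compression (Φ : Matrix n n ℂ →ₗ[ℂ] Matrix n n ℂ) (v : n → ℂ) :
    Matrix n n ℂ :=
  LinearMap.toMatrix'
    { toFun := fun y => Φ (vecMulVec y (star v)) *ᵥ v
      map_add' := fun x y => by simp [add_vecMulVec, add_mulVec]
      map_smul' := fun c x => by simp [smul_vecMulVec, smul_mulVec] }

lemma compression_mulVec (Φ : Matrix n n ℂ →ₗ[ℂ] Matrix n n ℂ) (v y : n → ℂ) :
    compression Φ v *ᵥ y = Φ (vecMulVec y (star v)) *ᵥ v := by
  rw [compression, LinearMap.toMatrix'_mulVec]; rfl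

variable (Ψ : Matrix n n ℂ →CP Matrix n n ℂ) {v : n → ℂ} (hv : star v ⬝ᵥ v = 1)
  (hfix : Ψ.toLinearMap (vecMulVec v (star v)) = vecMulVec v (star v))

include hv hfix

lemma compression_mulVec_self : compression Ψ.toLinearMap v *ᵥ v = v := by
  rw [compression_mulVec, hfix, vecMulVec_star_mulVec, hv, one_smul]

/-- Two-positivity of `Ψ` in the form of a Cauchy–Schwarz inequality. -/
lemma quadRe_compression_le (a : Matrix n n ℂ) (x y : n → ℂ) :
    2 * (star x ⬝ᵥ compression Ψ.toLinearMap v *ᵥ ((aᴴ * a) *ᵥ y)).re - quadRe y (aᴴ * a) ≤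
      quadRe x (Ψ.toLinearMap (aᴴ * a)) := by
  -- With b = a|y⟩⟨v|, b†b is a multiple of the fixed state |v⟩⟨v| and Ψ(a†b) v = K(a†a y). The
  -- vector -v supplies the sign of the cross term.
  have h := completelyPositiveMap_quadratic_nonneg Ψ a (a * vecMulVec y (star v)) x (-v)
  have hb : (a * vecMulVec y (star v))ᴴ * (a * vecMulVec y (star v)) =
      (star y ⬝ᵥ (aᴴ * a) *ᵥ y) • vecMulVec v (star v) := by
    rw [conjTranspose_mul, conjTranspose_vecMulVec_star, Matrix.mul_assoc, ← Matrix.mul_assoc aᴴ,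
      mul_vecMulVec, vecMulVec_mul_vecMulVec]
    ext i j; simp [vecMulVec_apply]; ring
  have hreal : (star y ⬝ᵥ (aᴴ * a) *ᵥ y).im = 0 :=
    (Complex.le_def.1 ((posSemidef_conjTranspose_mul_self a).dotProduct_mulVec_nonneg y)).2.symm
  rw [hb, map_smul, hfix, ← Matrix.mul_assoc, mul_vecMulVec] at h
  rw [compression_mulVec]
  have hq : quadRe (-v) ((star y ⬝ᵥ (aᴴ * a) *ᵥ y) • vecMulVec v (star v)) =
      quadRe y (aᴴ * a) := by
    simp [quadRe_apply, smul_mulVec, vecMulVec_star_mulVec, mulVec_neg, hv]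
  rw [hq, mulVec_neg, dotProduct_neg, Complex.neg_re] at h
  linarith

/-- Taking y = K†x in the Cauchy–Schwarz bound makes the cross term twice the subtracted form. -/
lemma quadRe_conjTranspose_compression_le {A : Matrix n n ℂ} (hA : A.PosSemidef) (x : n → ℂ) :
    quadRe ((compression Ψ.toLinearMap v)ᴴ *ᵥ x) A ≤ quadRe x (Ψ.toLinearMap A) := by
  obtain ⟨a, rfl⟩ := exists_eq_star_mul_self_of_nonneg hA.nonneg
  have h := quadRe_compression_le Ψ hv hfix a x ((compression Ψ.toLinearMap v)ᴴ *ᵥ x)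
  rw [star_dotProduct_mulVec, ← quadRe_apply] at h
  rw [star_eq_conjTranspose]
  linarith

/-- For A = |y⟩⟨y| with y = K†x, the previous bound and the trace give ‖y‖⁴ ≤ ‖y‖²‖x‖². -/
lemma compression_contraction (htr : ∀ A, (Ψ.toLinearMap A).trace = A.trace) (x : n → ℂ) :
    (star ((compression Ψ.toLinearMap v)ᴴ *ᵥ x) ⬝ᵥ ((compression Ψ.toLinearMap v)ᴴ *ᵥ x)).re ≤
      (star x ⬝ᵥ x).re := by
  set y := (compression Ψ.toLinearMap v)ᴴ *ᵥ x with hy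
  have hA : (vecMulVec y (star y)).PosSemidef := posSemidef_vecMulVec_self_star y
  have h := (quadRe_conjTranspose_compression_le Ψ hv hfix hA x).trans
    (quadRe_le_trace_mul (posSemidef_map Ψ hA) x)
  have him : (star y ⬝ᵥ y).im = 0 := (Complex.le_def.1 (dotProduct_star_self_nonneg y)).2.symm
  have hnn : 0 ≤ (star y ⬝ᵥ y).re := (Complex.le_def.1 (dotProduct_star_self_nonneg y)).1
  have hx : 0 ≤ (star x ⬝ᵥ x).re := (Complex.le_def.1 (dotProduct_star_self_nonneg x)).1
  rw [htr, trace_vecMulVec, dotProduct_comm, ← hy, quadRe_apply, vecMulVec_star_mulVec,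
    dotProduct_smul, smul_eq_mul, Complex.mul_re, him] at h
  rcases hnn.eq_or_lt with h0 | h0
  · rw [← h0]; exact hx
  · nlinarith

/-- With y = K†v, ⟨y,v⟩ = 1 and ‖y‖ ≤ 1 force ‖y - v‖² ≤ 0. -/
lemma conjTranspose_compression_mulVec_self
    (htr : ∀ A, (Ψ.toLinearMap A).trace = A.trace) :
    (compression Ψ.toLinearMap v)ᴴ *ᵥ v = v := by
  have h := compression_contraction Ψ hv hfix htr v
  set y := (compression Ψ.toLinearMap v)ᴴ *ᵥ v with hy
  have h1 : star y ⬝ᵥ v = 1 := by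
    rw [hy, ← star_dotProduct_mulVec, compression_mulVec_self Ψ hv hfix, hv]
  have h2 : (star v ⬝ᵥ y).re = 1 := by rw [re_star_dotProduct_comm, h1]; rfl
  have h3 : 0 ≤ star (y - v) ⬝ᵥ (y - v) := dotProduct_star_self_nonneg _
  have h4 : star (y - v) ⬝ᵥ (y - v) = 0 := by
    refine le_antisymm (Complex.le_def.2 ⟨?_, (Complex.le_def.1 h3).2.symm⟩) h3
    simp only [star_sub, sub_dotProduct, dotProduct_sub, Complex.sub_re, h1, h2, hv,
      Complex.one_re, Complex.zero_re] at h ⊢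
    linarith
  exact sub_eq_zero.1 (dotProduct_star_self_eq_zero.1 h4)

/-- Monotonicity of `⟨v|A^s|v⟩` under completely positive trace-preserving maps that fix the pure
state `|v⟩⟨v|`. -/
lemma quadRe_rpow_le_map (htr : ∀ A, (Ψ.toLinearMap A).trace = A.trace)
    {A : Matrix n n ℂ} (hA : A.PosSemidef) {s : ℝ} (hs0 : 0 < s) (hs1 : s ≤ 1) :
    quadRe v (A ^ s) ≤ quadRe v (Ψ.toLinearMap A ^ s) :=
  quadRe_rpow_le_of_contraction hA.nonneg (posSemidef_map Ψ hA).nonneg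
    (compression_mulVec_self Ψ hv hfix) (conjTranspose_compression_mulVec_self Ψ hv hfix htr)
    (compression_contraction Ψ hv hfix htr)
    (quadRe_conjTranspose_compression_le Ψ hv hfix hA) hs0 hs1

end CompletePositivity

/-- A non-negative, monotone, concave function on a cone which is homogeneous of degree `s` has a
concave `s`-th root. -/
lemma ConcaveOn.rpow_inv_of_homogeneous {E : Type*} [AddCommGroup E] [Module ℝ E] [PartialOrder E]
    [IsOrderedAddMonoid E] [PosSMulMono ℝ E] {g : E → ℝ} {s : ℝ} (hs : 0 < s)
    (hg : ConcaveOn ℝ (Set.Ici 0) g) (hg0 : ∀ x, 0 ≤ x → 0 ≤ g x)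
    (hmono : ∀ x y, 0 ≤ x → x ≤ y → g x ≤ g y)
    (hsmul : ∀ c : ℝ, 0 ≤ c → ∀ x, 0 ≤ x → g (c • x) = c ^ s * g x) :
    ConcaveOn ℝ (Set.Ici 0) fun x => g x ^ s⁻¹ := by
  have hhom : ∀ c : ℝ, 0 ≤ c → ∀ x, 0 ≤ x → g (c • x) ^ s⁻¹ = c * g x ^ s⁻¹ := by
    intro c hc x hx
    rw [hsmul c hc x hx, Real.mul_rpow (Real.rpow_nonneg hc s) (hg0 x hx),
      Real.rpow_rpow_inv hc hs.ne']
  have hnn : ∀ x, 0 ≤ x → 0 ≤ g x ^ s⁻¹ := fun x hx => Real.rpow_nonneg (hg0 x hx) _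
  have hmono' : ∀ x y, 0 ≤ x → x ≤ y → g x ^ s⁻¹ ≤ g y ^ s⁻¹ := fun x y hx hxy =>
    Real.rpow_le_rpow (hg0 x hx) (hmono x y hx hxy) (inv_nonneg.2 hs.le)
  have hsuper : ∀ x y, 0 ≤ x → 0 ≤ y → g x ^ s⁻¹ + g y ^ s⁻¹ ≤ g (x + y) ^ s⁻¹ := by
    intro x y hx hy
    rcases (hnn x hx).eq_or_lt with ha | ha
    · rw [← ha, zero_add]; exact hmono' _ _ hy (le_add_of_nonneg_left hx)
    rcases (hnn y hy).eq_or_lt with hb | hb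
    · rw [← hb, add_zero]; exact hmono' _ _ hx (le_add_of_nonneg_right hy)
    -- Rescale x and y to the level g = 1; then x + y is a + b times a convex combination of the
    -- rescaled points, where g ≥ 1 by concavity.
    set a := g x ^ s⁻¹ with hadef
    set b := g y ^ s⁻¹ with hbdef
    have hga : g (a⁻¹ • x) = 1 := by
      rw [hsmul _ (inv_nonneg.2 ha.le) x hx, Real.inv_rpow ha.le, hadef,
        Real.rpow_inv_rpow (hg0 x hx) hs.ne', inv_mul_cancel₀]
      rintro h; rw [hadef, h, Real.zero_rpow (inv_ne_zero hs.ne')] at ha; exact ha.false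
    have hgb : g (b⁻¹ • y) = 1 := by
      rw [hsmul _ (inv_nonneg.2 hb.le) y hy, Real.inv_rpow hb.le, hbdef,
        Real.rpow_inv_rpow (hg0 y hy) hs.ne', inv_mul_cancel₀]
      rintro h; rw [hbdef, h, Real.zero_rpow (inv_ne_zero hs.ne')] at hb; exact hb.false
    have hx' : 0 ≤ a⁻¹ • x := smul_nonneg (inv_nonneg.2 ha.le) hx
    have hy' : 0 ≤ b⁻¹ • y := smul_nonneg (inv_nonneg.2 hb.le) hy
    have hab : 0 < a + b := add_pos ha hb
    have hconc := hg.2 hx' hy' (div_nonneg ha.le hab.le) (div_nonneg hb.le hab.le)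
      (by field_simp)
    rw [hga, hgb, smul_eq_mul, smul_eq_mul, mul_one, mul_one, ← add_div, div_self hab.ne'] at hconc
    set w := (a / (a + b)) • a⁻¹ • x + (b / (a + b)) • b⁻¹ • y with hw
    have hw0 : 0 ≤ w := add_nonneg (smul_nonneg (div_nonneg ha.le hab.le) hx')
      (smul_nonneg (div_nonneg hb.le hab.le) hy')
    have hxy : x + y = (a + b) • w := by
      rw [hw, smul_add, smul_smul, smul_smul, smul_smul, smul_smul]
      have e1 : (a + b) * (a / (a + b)) * a⁻¹ = 1 := by field_simp
      have e2 : (a + b) * (b / (a + b)) * b⁻¹ = 1 := by field_simp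
      rw [e1, e2, one_smul, one_smul]
    rw [hxy, hhom _ hab.le w hw0]
    exact le_mul_of_one_le_right hab.le (Real.one_le_rpow hconc (inv_nonneg.2 hs.le))
  refine ⟨convex_Ici 0, fun x hx y hy a b ha hb _ => ?_⟩
  simp only [smul_eq_mul]
  rw [← hhom a ha x hx, ← hhom b hb y hy]
  exact hsuper _ _ (smul_nonneg ha hx) (smul_nonneg hb hy)

/-! ### Concavity and bounds for ⟨v|A^s|v⟩ -/

section Powers
open scoped Matrix.Norms.L2Operator
variable {n : Type*} [Fintype n] [DecidableEq n]

lemma posSemidef_rpow (A : Matrix n n ℂ) (s : ℝ) : (A ^ s).PosSemidef := by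
  have h : 0 ≤ A ^ s := CFC.rpow_nonneg
  exact nonneg_iff_posSemidef.1 h

lemma concaveOn_quadRe_rpow (v : n → ℂ) {s : ℝ} (hs0 : 0 < s) (hs1 : s ≤ 1) :
    ConcaveOn ℝ (Set.Ici (0 : Matrix n n ℂ)) fun A => quadRe v (A ^ s) ^ s⁻¹ := by
  refine ConcaveOn.rpow_inv_of_homogeneous hs0 ⟨convex_Ici 0, ?_⟩ ?_ ?_ ?_
  · intro A hA B hB a b ha hb hab
    have h := quadRe_mono ((CFC.concaveOn_rpow ⟨hs0.le, hs1⟩).2 hA hB ha hb hab) v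
    simpa using h
  · exact fun A _ => quadRe_nonneg (posSemidef_rpow A s) v
  · intro A B _ hAB
    have h : A ^ s ≤ B ^ s := CFC.rpow_le_rpow ⟨hs0.le, hs1⟩ hAB
    exact quadRe_mono h v
  · intro c hc A hA
    rw [rpow_smul_nonneg hA hc hs0, map_smul, smul_eq_mul]

lemma rpow_of_isIdempotentElem {A : Matrix n n ℂ} (hA : 0 ≤ A) (h : IsIdempotentElem A) {r : ℝ}
    (hr : 0 < r) : A ^ r = A := by
  rw [CFC.rpow_eq_cfc_real (a := A) hA]
  conv_rhs => rw [← cfc_id ℝ A hA.isSelfAdjoint]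
  refine cfc_congr fun x hx => ?_
  rcases h.spectrum_subset ℝ hx with rfl | rfl
  · simp [Real.zero_rpow hr.ne']
  · simp

lemma quadRe_rpow_le_one {A : Matrix n n ℂ} (hA : A.PosSemidef) (htr : A.trace = 1) {v : n → ℂ}
    (hv : star v ⬝ᵥ v = 1) {s : ℝ} (hs0 : 0 ≤ s) (hs1 : s ≤ 1) : quadRe v (A ^ s) ≤ 1 := by
  have h1 : A ≤ 1 := by simpa [htr] using le_trace_smul_one hA
  have h := quadRe_mono (CFC.rpow_le_rpow ⟨hs0, hs1⟩ h1) v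
  rwa [CFC.one_rpow, quadRe_apply v 1, one_mulVec, hv, Complex.one_re] at h

end Powers

/-! ### The state f₁ and the texture measure -/

lemma star_ketF1_dotProduct {d : ℕ} (hd : 0 < d) : star (ketF1 d) ⬝ᵥ ketF1 d = 1 := by
  have hd' : (0 : ℝ) < d := by exact_mod_cast hd
  have h : (d : ℝ) * ((1 / Real.sqrt d) * (1 / Real.sqrt d)) = 1 := by
    rw [div_mul_div_comm, Real.mul_self_sqrt hd'.le]; field_simp
  simp only [dotProduct, ketF1, Pi.star_apply, Complex.star_def, Complex.conj_ofReal,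
    Finset.sum_const, Finset.card_univ, Fintype.card_fin, nsmul_eq_mul]
  exact_mod_cast h

lemma posSemidef_f1 (d : ℕ) : (f1 d).PosSemidef := posSemidef_vecMulVec_self_star _

lemma trace_f1 {d : ℕ} (hd : 0 < d) : (f1 d).trace = 1 := by
  rw [f1, trace_vecMulVec, dotProduct_comm, star_ketF1_dotProduct hd]

lemma f1_mul_mul_f1 {d : ℕ} (A : Matrix (Fin d) (Fin d) ℂ) : f1 d * A * f1 d = expF1 A • f1 d := by
  rw [f1, vecMulVec_mul, vecMulVec_mul_vecMulVec, ← dotProduct_mulVec]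
  ext i j; simp [vecMulVec_apply, expF1]; ring

lemma f1_rpow {d : ℕ} (hd : 0 < d) {r : ℝ} (hr : 0 < r) : f1 d ^ r = f1 d := by
  refine rpow_of_isIdempotentElem (posSemidef_f1 d).nonneg ?_ hr
  have h := f1_mul_mul_f1 (1 : Matrix (Fin d) (Fin d) ℂ)
  rwa [mul_one, expF1, one_mulVec, star_ketF1_dotProduct hd, one_smul] at h

lemma re_expF1 {d : ℕ} (A : Matrix (Fin d) (Fin d) ℂ) : (expF1 A).re = quadRe (ketF1 d) A := rfl

lemma renyiF_f1 {d : ℕ} (hd : 0 < d) {α z : ℝ} (hα : 0 < α) (hz : 0 < z)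
    (ρ : Matrix (Fin d) (Fin d) ℂ) :
    renyiF α z (f1 d) ρ = (expF1 (ρ ^ ((1 - α) / z))).re ^ z := by
  have hP : (ρ ^ ((1 - α) / z)).PosSemidef := posSemidef_rpow _ _
  have hq : 0 ≤ expF1 (ρ ^ ((1 - α) / z)) := hP.dotProduct_mulVec_nonneg (ketF1 d)
  rw [Complex.le_def] at hq
  -- The scalar must be a non-negative real to leave the `z`-th power.
  have hexp : expF1 (ρ ^ ((1 - α) / z)) = ((expF1 (ρ ^ ((1 - α) / z))).re : ℂ) :=
    Complex.ext rfl (by simpa using hq.2.symm)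
  rw [renyiF, f1_rpow hd (by positivity), f1_mul_mul_f1, hexp, Complex.coe_smul,
    rpow_smul_nonneg (posSemidef_f1 d).nonneg hq.1 hz, f1_rpow hd hz, trace_smul, trace_f1 hd]
  simp

lemma isTextureMeasure_textureGR {d : ℕ} (hd : 0 < d) {α z : ℝ} (hα0 : 0 < α) (hα1 : α < 1)
    (hz : max α (1 - α) ≤ z) : IsTextureMeasure d (textureGR α z) := by
  have hz0 : 0 < z := hα0.trans_le ((le_max_left _ _).trans hz)
  have hformula := fun ρ => renyiF_f1 hd (α := α) hα0 hz0 ρ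
  have hψ := star_ketF1_dotProduct hd
  have hs0 : 0 < (1 - α) / z := div_pos (by linarith) hz0
  have hs1 : (1 - α) / z ≤ 1 := (div_le_one hz0).2 ((le_max_right _ _).trans hz)
  have hsz : (1 - α) / z * z = 1 - α := div_mul_cancel₀ _ hz0.ne'
  set s := (1 - α) / z with hs
  have hT : ∀ ρ, textureGR α z ρ = 1 - quadRe (ketF1 d) (ρ ^ s) ^ z := fun ρ => by
    rw [textureGR, hformula, re_expF1]
  have hnn : ∀ ρ : Matrix (Fin d) (Fin d) ℂ, 0 ≤ quadRe (ketF1 d) (ρ ^ s) := fun ρ =>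
    quadRe_nonneg (posSemidef_rpow ρ s) _
  refine ⟨fun ρ hρ => ?_, ?_, ?_, ?_⟩
  · rw [hT, sub_nonneg]
    exact Real.rpow_le_one (hnn ρ)
      (quadRe_rpow_le_one hρ.posSemidef hρ.trace_eq_one hψ hs0.le hs1) hz0.le
  · have h1 : quadRe (ketF1 d) (f1 d) = 1 := by
      rw [quadRe_apply, f1, vecMulVec_star_mulVec, hψ, one_smul, hψ, Complex.one_re]
    rw [hT, f1_rpow hd hs0, h1, Real.one_rpow, sub_self]
  · rintro ρ hρ Φ ⟨⟨Ψ, rfl⟩, htr, hfix⟩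
    rw [hT, hT]
    exact sub_le_sub_left (Real.rpow_le_rpow (hnn ρ)
      (quadRe_rpow_le_map Ψ hψ hfix htr hρ.posSemidef hs0 hs1) hz0.le) 1
  · intro m ρ p hρ hp hsum
    -- Since z = (1-α)/s, the power z splits as 1/s followed by 1-α.
    have hroot : ∀ σ : Matrix (Fin d) (Fin d) ℂ, quadRe (ketF1 d) (σ ^ s) ^ z =
        (quadRe (ketF1 d) (σ ^ s) ^ s⁻¹) ^ (1 - α) := fun σ => by
      rw [← Real.rpow_mul (hnn σ), ← hsz, inv_mul_cancel_left₀ hs0.ne']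
    have h1 := (concaveOn_quadRe_rpow (ketF1 d) hs0 hs1).le_map_sum (t := Finset.univ)
      (fun i _ => hp i) hsum (p := ρ) fun i _ => (hρ i).posSemidef.nonneg
    have h2 := (Real.concaveOn_rpow (p := 1 - α) (by linarith) (by linarith)).le_map_sum
      (t := Finset.univ) (fun i _ => hp i) hsum (p := fun i => quadRe (ketF1 d) (ρ i ^ s) ^ s⁻¹)
      fun i _ => Real.rpow_nonneg (hnn (ρ i)) _
    have h3 := Real.rpow_le_rpow (z := 1 - α) (Finset.sum_nonneg fun i _ =>
      smul_nonneg (hp i) (Real.rpow_nonneg (hnn (ρ i)) s⁻¹)) h1 (by linarith)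
    have h4 := h2.trans h3
    simp only [smul_eq_mul, ← hroot] at h4
    simp only [hT, mul_sub, mul_one, Finset.sum_sub_distrib, hsum]
    linarith

end QuantumTexture

open scoped MatrixOrder
theorem theorem1 (d : ℕ) (hd : 0 < d) (α z : ℝ) (hα0 : 0 < α) (hα1 : α < 1)
    (hz : max α (1 - α) ≤ z) :
    QuantumTexture.IsTextureMeasure d (QuantumTexture.textureGR α z) ∧
    ∀ ρ : Matrix (Fin d) (Fin d) ℂ, QuantumTexture.IsState ρ →
      QuantumTexture.renyiF α z (QuantumTexture.f1 d) ρ =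
        (QuantumTexture.expF1 (ρ ^ ((1 - α) / z))).re ^ z := by
  have hz0 : 0 < z := hα0.trans_le ((le_max_left _ _).trans hz)
  exact ⟨QuantumTexture.isTextureMeasure_textureGR hd hα0 hα1 hz,
    fun ρ _ => QuantumTexture.renyiF_f1 hd hα0 hz0 ρ⟩
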